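/- Let $R$ be a commutative ring with identity and let $C$ be a semidualizing $R$-module, i.e. $C$ has a resolution by finitely generated projective $R$-modules, the homothety map $R\to\operatorname{Hom}_R(C,C)$ is an isomorphism, and $\operatorname{Ext}_R^{n}(C,C)=0$ for all $n\ge 1$. An $R$-module is called $C$-projective (resp. $C$-flat) if it is isomorphic to $C\otimes_R P$ with $P$ a projective (resp. flat) $R$-module. An $R$-module $M$ is called $D_C$-projective if there is an exact sequence of $R$-modules $$\cdots\to L^1\xrightarrow{\delta^1} L^0\xrightarrow{\delta^0} L^{-1}\xrightarrow{\delta^{-1}} L^{-2}\to\cdots$$ which remains exact after applying $\operatorname{Hom}_R(-,F)$ for every $C$-flat $R$-module $F$, with $L^i$ projective for all $i\ge 0$ and $L^i$ $C$-projective for all $i<0$, such that $M\cong\operatorname{Im}\delta^0$. A complex $H$ of $R$-modules is called $C$-flat if it is exact and each cycle module $Z_i(H)=\operatorname{Ker}(H^i\to H^{i-1})$, $i\in\mathbb{Z}$, is $C$-flat. Let $X$ be a ($\mathbb{Z}$-indexed) complex of $R$-modules. If $X$ is exact and $Z_i(X)$ is $D_C$-projective for every $i\in\mathbb{Z}$,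 then $\operatorname{Ext}^1(X,H)=0$ for every $C$-flat complex $H$, where $\operatorname{Ext}^1$ is taken in the abelian category $\operatorname{Ch}(R)$ of complexes of $R$-modules. -/

import Mathlib

open CategoryTheory CategoryTheory.Limits
open scoped TensorProduct

universe u

namespace DingComplex

variable {R : Type u} [CommRing R]

/-- An `R`-module `C` is semidualizing. -/
structure IsSemidualizing (C : ModuleCat.{u} R) : Prop where
  /-- `C` has a resolution by finitely generated projective modules. -/
  exists_resolution : ∃ P : ProjectiveResolution C, ∀ n : ℕ, Module.Finite R (P.complex.X n)
  /-- The homothety map `R → Hom_R(C, C)`, `r ↦ (c ↦ r • c)`, is an isomorphism. -/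
  homothety_bijective : Function.Bijective (LinearMap.lsmul R C : R →ₗ[R] (C →ₗ[R] C))
  /-- `Ext^n(C, C) = 0` for all `n ≥ 1`. -/
  ext_self : ∀ n : ℕ, 1 ≤ n → Subsingleton (Abelian.Ext C C n)

/-- `M` is `C`-projective: `M ≅ C ⊗ P` with `P` projective. -/
def IsCProjective (C M : ModuleCat.{u} R) : Prop :=
  ∃ P : ModuleCat.{u} R, Module.Projective R P ∧ Nonempty (M ≃ₗ[R] C ⊗[R] P)

/-- `M` is `C`-flat: `M ≅ C ⊗ F` with `F` flat. -/
def IsCFlat (C M : ModuleCat.{u} R) : Prop :=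
  ∃ F : ModuleCat.{u} R, Module.Flat R F ∧ Nonempty (M ≃ₗ[R] C ⊗[R] F)

/-- The sequence of abelian groups obtained by applying `Hom(-, N)` to the complex `L` is exact. -/
def HomExact (L : ChainComplex (ModuleCat.{u} R) ℤ) (N : ModuleCat.{u} R) : Prop :=
  ∀ i : ℤ, Function.Exact
    (fun f : L.X (i - 1) ⟶ N => L.d i (i - 1) ≫ f)
    (fun g : L.X i ⟶ N => L.d (i + 1) i ≫ g)

/-- `M` is `D_C`-projective: it is isomorphic to the image of `L 0 → L (-1)` for an exact,
`Hom(-, C-flat)`-exact complex `L` which is projective in degrees `≥ 0` and `C`-projective in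
degrees `< 0`. -/
def IsDCProjective (C M : ModuleCat.{u} R) : Prop :=
  ∃ L : ChainComplex (ModuleCat.{u} R) ℤ,
    L.Acyclic ∧
    (∀ F : ModuleCat.{u} R, IsCFlat C F → HomExact L F) ∧
    (∀ i : ℤ, 0 ≤ i → Module.Projective R (L.X i)) ∧
    (∀ i : ℤ, i < 0 → IsCProjective C (L.X i)) ∧
    Nonempty (M ≃ₗ[R] LinearMap.range (L.d 0 (-1)).hom)

/-- Given a class `P` of modules, `X` is a `P`-complex: `X` is exact and all its cycle modules
`Z_i(X) = Ker (X i → X (i - 1))` belong to `P`. -/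
def IsClassComplex (P : ModuleCat.{u} R → Prop) (X : ChainComplex (ModuleCat.{u} R) ℤ) : Prop :=
  X.Acyclic ∧ ∀ i : ℤ, P (X.cycles i)

/-- `H` is a `C`-flat complex. -/
def IsCFlatComplex (C : ModuleCat.{u} R) (H : ChainComplex (ModuleCat.{u} R) ℤ) : Prop :=
  IsClassComplex (IsCFlat C) H

end DingComplex

/-! The statement reduces to modules. A `D_C`-projective module is a quotient of the projective `L.X
0` by the cycles in degree 0, and `Hom(-, F)`-exactness extends every map from these cycles to a
`C`-flat `F`; hence `Ext¹` from each cycle module of `X` to each cycle module of `H` vanishes.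

Now embed `H` in an injective complex `I` with quotient `Q`; it suffices to lift each `X ⟶ Q` to
`I`. The kernel of `(g, d) : I_i → Q_i × I_{i-1}` is `Z_i(H)`, and exactness of `H` puts every
compatible pair in its image, so the obstructions lie in `Ext¹(-, Z_i(H))`. Lifting first on the
cycles of `X`, then extending to each `X_i`, gives a chain map without induction on the degree. -/

namespace CategoryTheory

/-! ### Vanishing of `Ext¹` as lifting and extension of morphisms. -/

section Orthogonality

variable {𝒜 : Type*} [Category 𝒜] [Abelian 𝒜] [HasExt 𝒜]

/-- A morphism from `A` lifts along the epimorphism of a short exact sequence if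
`Ext¹` from `A` to the kernel vanishes. -/
lemma ShortComplex.ShortExact.exists_lift {S : ShortComplex 𝒜} (hS : S.ShortExact) {A : 𝒜}
    (hA : Subsingleton (Abelian.Ext A S.X₁ 1)) (φ : A ⟶ S.X₃) :
    ∃ ψ : A ⟶ S.X₂, ψ ≫ S.g = φ := by
  obtain ⟨x, hx⟩ := Abelian.Ext.covariant_sequence_exact₃ A hS (Abelian.Ext.mk₀ φ) (zero_add 1)
    (Subsingleton.elim _ _)
  obtain ⟨ψ, rfl⟩ := Abelian.Ext.mk₀_bijective _ _ |>.surjective x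
  refine ⟨ψ, (Abelian.Ext.mk₀_bijective _ _).injective ?_⟩
  simpa using hx

/-- A morphism to `B` extends along the monomorphism of a short exact sequence if
`Ext¹` from the cokernel to `B` vanishes. -/
lemma ShortComplex.ShortExact.exists_extension {S : ShortComplex 𝒜} (hS : S.ShortExact) {B : 𝒜}
    (hB : Subsingleton (Abelian.Ext S.X₃ B 1)) (φ : S.X₁ ⟶ B) :
    ∃ ψ : S.X₂ ⟶ B, S.f ≫ ψ = φ := by
  obtain ⟨x, hx⟩ := Abelian.Ext.contravariant_sequence_exact₁ hS B (Abelian.Ext.mk₀ φ)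
    (add_zero 1) (Subsingleton.elim _ _)
  obtain ⟨ψ, rfl⟩ := Abelian.Ext.mk₀_bijective _ _ |>.surjective x
  refine ⟨ψ, (Abelian.Ext.mk₀_bijective _ _).injective ?_⟩
  simpa using hx

/-- If `Ext¹` to `B` vanishes on the outer terms of a short exact sequence, it vanishes on the
middle term. -/
lemma ShortComplex.ShortExact.subsingleton_ext_X₂ {S : ShortComplex 𝒜} (hS : S.ShortExact)
    {B : 𝒜} {n : ℕ} (h₁ : Subsingleton (Abelian.Ext S.X₁ B n))
    (h₃ : Subsingleton (Abelian.Ext S.X₃ B n)) : Subsingleton (Abelian.Ext S.X₂ B n) := by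
  refine subsingleton_of_forall_eq 0 fun x ↦ ?_
  obtain ⟨y, rfl⟩ := Abelian.Ext.contravariant_sequence_exact₂ hS B x (Subsingleton.elim _ _)
  rw [Subsingleton.elim y 0, Abelian.Ext.comp_zero]

/-- If every morphism from the kernel of an epimorphism `P ⟶ A`, with `P` projective, to `B`
extends to `P`, then `Ext¹(A, B)` vanishes. -/
lemma ShortComplex.ShortExact.subsingleton_ext_one_of_projective {S : ShortComplex 𝒜}
    (hS : S.ShortExact) [Projective S.X₂] {B : 𝒜}
    (h : ∀ φ : S.X₁ ⟶ B, ∃ ψ : S.X₂ ⟶ B, S.f ≫ ψ = φ) :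
    Subsingleton (Abelian.Ext S.X₃ B 1) := by
  refine subsingleton_of_forall_eq 0 fun x ↦ ?_
  obtain ⟨y, rfl⟩ := Abelian.Ext.contravariant_sequence_exact₃ hS B x
    (Abelian.Ext.eq_zero_of_projective _) (add_zero 1)
  obtain ⟨φ, rfl⟩ := (Abelian.Ext.mk₀_bijective _ _).surjective y
  obtain ⟨ψ, rfl⟩ := h φ
  rw [← Abelian.Ext.mk₀_comp_mk₀, ShortComplex.ShortExact.extClass_comp_assoc]

/-- If every morphism from `A` to the cokernel of a monomorphism `B ⟶ I`, with `I` injective,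
lifts to `I`, then `Ext¹(A, B)` vanishes. -/
lemma ShortComplex.ShortExact.subsingleton_ext_one_of_injective {S : ShortComplex 𝒜}
    (hS : S.ShortExact) [Injective S.X₂] {A : 𝒜}
    (h : ∀ φ : A ⟶ S.X₃, ∃ ψ : A ⟶ S.X₂, ψ ≫ S.g = φ) :
    Subsingleton (Abelian.Ext A S.X₁ 1) := by
  refine subsingleton_of_forall_eq 0 fun x ↦ ?_
  obtain ⟨y, rfl⟩ := Abelian.Ext.covariant_sequence_exact₁ A hS x
    (Abelian.Ext.eq_zero_of_injective _) (zero_add 1)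
  obtain ⟨φ, rfl⟩ := (Abelian.Ext.mk₀_bijective _ _).surjective y
  obtain ⟨ψ, rfl⟩ := h φ
  rw [← Abelian.Ext.mk₀_comp_mk₀, Abelian.Ext.comp_assoc_of_second_deg_zero,
    ShortComplex.ShortExact.comp_extClass, Abelian.Ext.comp_zero]

end Orthogonality

end CategoryTheory

/-! ### Short exact sequences of cycles. -/

namespace HomologicalComplex

variable {𝒜 ι : Type*} [Category 𝒜] [Abelian 𝒜] {c : ComplexShape ι}

/-- If the differential `K.X i ⟶ K.X j` factors as an epimorphism `q` followed by a monomorphism,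
then `q` is the cokernel of the inclusion of the cycles in degree `i`. -/
lemma shortExact_iCycles
    (K : HomologicalComplex 𝒜 c) {i j : ι} (hij : c.Rel i j) {Q : 𝒜} (q : K.X i ⟶ Q)
    (m : Q ⟶ K.X j) [Epi q] [Mono m] (fac : q ≫ m = K.d i j) :
    (ShortComplex.mk (K.iCycles i) q (by simp [← cancel_mono m, fac])).ShortExact where
  exact := by
    have hk {A : 𝒜} (k : A ⟶ K.X i) (h : k ≫ q = 0) : k ≫ K.d i j = 0 := by
      rw [← fac, reassoc_of% h, zero_comp]
    exact ShortComplex.exact_of_f_is_kernel _ (KernelFork.IsLimit.ofι' _ _ fun k h ↦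
      ⟨K.liftCycles k j (c.next_eq' hij) (hk k h), K.liftCycles_i _ _ _ _⟩)

lemma ExactAt.epi_toCycles
    {K : HomologicalComplex 𝒜 c} {i j : ι} (hij : c.Rel i j) (hj : K.ExactAt j) :
    Epi (K.toCycles i j) := by
  have := (K.exactAt_iff_isZero_homology j).1 hj
  exact (ShortComplex.exact_of_g_is_cokernel (.mk _ _ (K.toCycles_comp_homologyπ i j))
    (K.homologyIsCokernel i j (c.prev_eq' hij))).epi_f (this.eq_of_tgt _ _)

/-- The short exact sequence `0 ⟶ Z i ⟶ K i ⟶ Z j ⟶ 0` of a complex that is exact at `j`. -/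
lemma ExactAt.shortExact_cycles
    {K : HomologicalComplex 𝒜 c} {i j : ι} (hij : c.Rel i j) (hj : K.ExactAt j) :
    (ShortComplex.mk (K.iCycles i) (K.toCycles i j)
      (by simp [← cancel_mono (K.iCycles j)])).ShortExact :=
  have := hj.epi_toCycles hij
  K.shortExact_iCycles hij _ (K.iCycles j) (K.toCycles_i i j)

end HomologicalComplex

/-! ### The orthogonality at the level of modules. -/

namespace DingComplex

variable {R : Type u} [CommRing R]

/-- `Ext¹` from a `D_C`-projective module to a `C`-flat module vanishes. -/
lemma IsDCProjective.subsingleton_ext_one {C M F : ModuleCat.{u} R} (hM : IsDCProjective C M)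
    (hF : IsCFlat C F) : Subsingleton (Abelian.Ext M F 1) := by
  obtain ⟨L, hL, hHom, hproj, -, ⟨e⟩⟩ := hM
  let q : L.X 0 ⟶ M := ModuleCat.ofHom (e.symm.toLinearMap ∘ₗ (L.d 0 (-1)).hom.rangeRestrict)
  let m : M ⟶ L.X (-1) := ModuleCat.ofHom
    ((LinearMap.range (L.d 0 (-1)).hom).subtype ∘ₗ e.toLinearMap)
  have fac : q ≫ m = L.d 0 (-1) := by ext x; simp [q, m]
  have : Epi q := (ModuleCat.epi_iff_surjective _).2
    (e.symm.surjective.comp (LinearMap.surjective_rangeRestrict _))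
  have : Mono m := (ModuleCat.mono_iff_injective _).2
    (Subtype.val_injective.comp e.injective)
  have := hproj 0 le_rfl
  have : Projective (L.X 0) := (IsProjective.iff_projective _).1 this
  refine (L.shortExact_iCycles (by simp) q m fac).subsingleton_ext_one_of_projective fun φ ↦ ?_
  -- Precomposing `φ` with `L.X 1 ⟶ Z_0(L)` gives a cocycle on `L.X 1`, hence a map of the form `d ≫
  -- ψ`; since `L.X 1 ⟶ Z_0(L)` is epi, this `ψ` extends `φ`.
  obtain ⟨ψ, hψ⟩ := (hHom F hF 1 (L.toCycles 1 0 ≫ φ)).1 (by simp)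
  refine ⟨ψ, ?_⟩
  have : Epi (L.toCycles 1 0) := (hL 0).epi_toCycles (by simp)
  rw [← cancel_epi (L.toCycles 1 0), L.toCycles_i_assoc]
  exact hψ

end DingComplex

namespace ModuleCat

variable {R : Type u} [CommRing R]

/-- A version of lifting along a short exact sequence for a left exact sequence and a morphism
with values in the image. -/
lemma exists_lift_of_exact {S : ShortComplex (ModuleCat.{u} R)} (hS : S.Exact) (hf : Mono S.f)
    {A : ModuleCat.{u} R} (hA : Subsingleton (Abelian.Ext A S.X₁ 1)) (θ : A ⟶ S.X₃)
    (hθ : ∀ a, ∃ y, S.g y = θ a) : ∃ ψ : A ⟶ S.X₂, ψ ≫ S.g = θ := by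
  -- Replacing the third term by the range of `S.g` makes the sequence short exact.
  have hS' : (ShortComplex.mk S.f (ofHom S.g.hom.rangeRestrict) (by
      ext x
      exact congr($(S.zero).hom x))).ShortExact :=
    { exact := by
        rw [ShortComplex.moduleCat_exact_iff] at hS ⊢
        exact fun x hx ↦ hS x congr(($hx).1)
      epi_g := (epi_iff_surjective _).2 (LinearMap.surjective_rangeRestrict _) }
  obtain ⟨ψ, hψ⟩ := hS'.exists_lift hA (ofHom (θ.hom.codRestrict (LinearMap.range S.g.hom) hθ))
  refine ⟨ψ, ?_⟩
  ext a
  exact congr(($hψ a).1)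

end ModuleCat

namespace HomologicalComplex

variable {R : Type u} [CommRing R] {ι : Type*} {c : ComplexShape ι}

lemma ExactAt.exists_d_eq {K : HomologicalComplex (ModuleCat.{u} R) c} {i j k : ι}
    (hj : K.ExactAt j) (hij : c.Rel i j) (hjk : c.Rel j k) (x : K.X j) (hx : K.d j k x = 0) :
    ∃ y, K.d i j y = x :=
  (ShortComplex.moduleCat_exact_iff _).1
    ((K.exactAt_iff' i j k (c.prev_eq' hij) (c.next_eq' hjk)).1 hj) x hx

lemma exists_iCycles_eq (K : HomologicalComplex (ModuleCat.{u} R) c) {i j : ι}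
    (hij : c.Rel i j) (x : K.X i) (hx : K.d i j x = 0) : ∃ y, K.iCycles i y = x :=
  (ShortComplex.moduleCat_exact_iff (.mk _ _ (K.iCycles_d i j))).1
    (ShortComplex.exact_of_f_is_kernel _ (K.cyclesIsKernel i j (c.next_eq' hij))) x hx

variable {S : ShortComplex (HomologicalComplex (ModuleCat.{u} R) c)}

lemma exists_f_eq (hS : S.ShortExact) (i : ι) (y : S.X₂.X i) (hy : S.g.f i y = 0) : ∃ x, S.f.f i x = y :=
  (ShortComplex.moduleCat_exact_iff _).1
    ((shortExact_iff_degreewise_shortExact S).1 hS i).exact y hy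

lemma f_f_comp_g_f (S : ShortComplex (HomologicalComplex (ModuleCat.{u} R) c)) (i : ι) :
    S.f.f i ≫ S.g.f i = 0 := by
  rw [← comp_f, S.zero, zero_f]

lemma f_injective (hS : S.ShortExact) (i : ι) : Function.Injective (S.f.f i) :=
  (ModuleCat.mono_iff_injective _).1 ((shortExact_iff_degreewise_shortExact S).1 hS i).mono_f

lemma g_surjective (hS : S.ShortExact) (i : ι) : Function.Surjective (S.g.f i) :=
  (ModuleCat.epi_iff_surjective _).1 ((shortExact_iff_degreewise_shortExact S).1 hS i).epi_g

end HomologicalComplex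

/-! ### Lifting morphisms of complexes degree by degree. -/

namespace ChainComplex

variable {R : Type u} [CommRing R]

section Lift

variable {S : ShortComplex (ChainComplex (ModuleCat.{u} R) ℤ)}

open HomologicalComplex in
/-- In a short exact sequence of complexes with exact kernel, an element of `S.X₂.X i` can be found
with prescribed image in `S.X₃` and prescribed differential, as soon as these are compatible. -/
lemma exists_g_eq_and_d_eq (hS : S.ShortExact) (hH : S.X₁.Acyclic) {i j k : ℤ}
    (hij : (ComplexShape.down ℤ).Rel i j) (hjk : (ComplexShape.down ℤ).Rel j k)
    (x : S.X₃.X i) (y : S.X₂.X j) (hxy : S.X₃.d i j x = S.g.f j y) (hy : S.X₂.d j k y = 0) :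
    ∃ e, S.g.f i e = x ∧ S.X₂.d i j e = y := by
  obtain ⟨e, rfl⟩ := g_surjective hS i x
  have hd : S.g.f j (S.X₂.d i j e - y) = 0 := by
    rw [map_sub, ← hxy, sub_eq_zero]
    exact congr($(S.g.comm i j).hom e).symm
  -- The error in the differential comes from a cycle `h` of `S.X₁`; by exactness it is a boundary,
  -- and subtracting a preimage corrects `e` without changing its image in `S.X₃`.
  obtain ⟨h, hh⟩ := exists_f_eq hS j _ hd
  have hdh : S.X₁.d j k h = 0 := by
    refine f_injective hS k ?_
    rw [map_zero]
    refine (congr($(S.f.comm j k).hom h)).symm.trans ?_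
    change S.X₂.d j k (S.f.f j h) = 0
    rw [hh, map_sub, hy, sub_zero]
    exact congr($(S.X₂.d_comp_d i j k).hom e)
  obtain ⟨h', rfl⟩ := (hH j).exists_d_eq hij hjk h hdh
  refine ⟨e - S.f.f i h', ?_, ?_⟩
  · rw [map_sub, sub_eq_self]
    exact congr($(f_f_comp_g_f S i).hom h')
  · have : S.X₂.d i j (S.f.f i h') = S.f.f j (S.X₁.d i j h') := congr($(S.f.comm i j).hom h')
    rw [map_sub, this, hh, sub_sub_cancel]

/-- The pair `(S.g, d)` on `S.X₂.X i`, preceded by the inclusion of the cycles of `S.X₁`. -/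
noncomputable def cyclesProdShortComplex (S : ShortComplex (ChainComplex (ModuleCat.{u} R) ℤ))
    (i j : ℤ) : ShortComplex (ModuleCat.{u} R) where
  X₁ := S.X₁.cycles i
  X₂ := S.X₂.X i
  X₃ := ModuleCat.of R (S.X₃.X i × S.X₂.X j)
  f := S.X₁.iCycles i ≫ S.f.f i
  g := ModuleCat.ofHom ((S.g.f i).hom.prod (S.X₂.d i j).hom)
  zero := by
    ext x
    · exact congr($(HomologicalComplex.f_f_comp_g_f S i).hom (S.X₁.iCycles i x))
    · have : (S.X₁.iCycles i ≫ S.f.f i) ≫ S.X₂.d i j = 0 := by simp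
      exact congr($(this).hom x)

lemma cyclesProdShortComplex_mono (hS : S.ShortExact) (i j : ℤ) :
    Mono (cyclesProdShortComplex S i j).f :=
  have : Mono (S.f.f i) := (ModuleCat.mono_iff_injective _).2 (HomologicalComplex.f_injective hS i)
  mono_comp (S.X₁.iCycles i) (S.f.f i)

-- What `S.g` kills comes from `S.X₁`, and if the differential also kills it, injectivity of `S.f`
-- makes it a cycle there. Obstructions to lifting along `(S.g, d)` thus involve only the cycles of
-- `S.X₁`.
open HomologicalComplex in
lemma cyclesProdShortComplex_exact (hS : S.ShortExact) {i j : ℤ}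
    (hij : (ComplexShape.down ℤ).Rel i j) : (cyclesProdShortComplex S i j).Exact := by
  rw [ShortComplex.moduleCat_exact_iff]
  intro x hx
  obtain ⟨h, rfl⟩ := exists_f_eq hS i x congr(($hx).1)
  have hd : S.X₂.d i j (S.f.f i h) = 0 := congr(($hx).2)
  have : S.X₁.d i j h = 0 := by
    refine f_injective hS j ?_
    rw [map_zero]
    exact congr($(S.f.comm i j).hom h).symm.trans hd
  obtain ⟨z, rfl⟩ := S.X₁.exists_iCycles_eq hij h this
  exact ⟨z, rfl⟩

/-- If `S.X₁` is exact, a pair of compatible morphisms to `S.X₃.X i` and to the cycles of `S.X₂`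
in degree `j` lifts to `S.X₂.X i` whenever `Ext¹` to the cycles of `S.X₁` vanishes. -/
lemma exists_lift_comp_g_and_comp_d (hS : S.ShortExact) (hH : S.X₁.Acyclic) {i j k : ℤ}
    (hij : (ComplexShape.down ℤ).Rel i j) (hjk : (ComplexShape.down ℤ).Rel j k)
    {A : ModuleCat.{u} R} (hA : Subsingleton (Abelian.Ext A (S.X₁.cycles i) 1))
    (α : A ⟶ S.X₃.X i) (β : A ⟶ S.X₂.X j) (hαβ : α ≫ S.X₃.d i j = β ≫ S.g.f j)
    (hβ : β ≫ S.X₂.d j k = 0) :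
    ∃ γ : A ⟶ S.X₂.X i, γ ≫ S.g.f i = α ∧ γ ≫ S.X₂.d i j = β := by
  obtain ⟨γ, hγ⟩ := ModuleCat.exists_lift_of_exact (cyclesProdShortComplex_exact hS hij)
    (cyclesProdShortComplex_mono hS i j) hA (ModuleCat.ofHom (α.hom.prod β.hom)) (fun a ↦ by
      obtain ⟨e, he₁, he₂⟩ := exists_g_eq_and_d_eq hS hH hij hjk (α a) (β a)
        congr($(hαβ).hom a) congr($(hβ).hom a)
      exact ⟨e, Prod.ext he₁ he₂⟩)
  refine ⟨γ, ?_, ?_⟩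
  · ext a
    exact congr(($hγ a).1)
  · ext a
    exact congr(($hγ a).2)

/-- A morphism to `S.X₂.X i` killed by `S.g` and by the differential factors through the cycles
of `S.X₁`. -/
lemma exists_comp_iCycles_comp_f (hS : S.ShortExact) {i j : ℤ}
    (hij : (ComplexShape.down ℤ).Rel i j) {A : ModuleCat.{u} R} (α : A ⟶ S.X₂.X i)
    (hg : α ≫ S.g.f i = 0) (hd : α ≫ S.X₂.d i j = 0) :
    ∃ μ : A ⟶ S.X₁.cycles i, μ ≫ S.X₁.iCycles i ≫ S.f.f i = α := by
  have hex := cyclesProdShortComplex_exact hS hij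
  have := cyclesProdShortComplex_mono hS i j
  have hw : α ≫ (cyclesProdShortComplex S i j).g = 0 :=
    ModuleCat.hom_ext (LinearMap.ext fun a ↦ Prod.ext congr($(hg).hom a) congr($(hd).hom a))
  exact ⟨hex.lift α hw, hex.lift_f α hw⟩

/-- The components of a lift of `φ : X ⟶ S.X₃` to `S.X₂` can be chosen so as to extend
given lifts on cycles. -/
lemma exists_lift_extending {X : ChainComplex (ModuleCat.{u} R) ℤ} (hS : S.ShortExact)
    (hX : X.Acyclic) (hH : S.X₁.Acyclic)
    (h : ∀ i i', Subsingleton (Abelian.Ext (X.cycles i) (S.X₁.cycles i') 1))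
    (φ : X ⟶ S.X₃) {i j k : ℤ}
    (hij : (ComplexShape.down ℤ).Rel i j) (hjk : (ComplexShape.down ℤ).Rel j k)
    (τi : X.cycles i ⟶ S.X₂.X i) (τj : X.cycles j ⟶ S.X₂.X j)
    (hi : τi ≫ S.g.f i = X.iCycles i ≫ φ.f i) (hi' : τi ≫ S.X₂.d i j = 0)
    (hj : τj ≫ S.g.f j = X.iCycles j ≫ φ.f j) (hj' : τj ≫ S.X₂.d j k = 0) :
    ∃ σ : X.X i ⟶ S.X₂.X i, σ ≫ S.g.f i = φ.f i ∧ σ ≫ S.X₂.d i j = X.toCycles i j ≫ τj ∧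
      X.iCycles i ≫ σ = τi := by
  have hses := (hX j).shortExact_cycles hij
  have hz : X.iCycles i ≫ X.toCycles i j = 0 := by simp [← cancel_mono (X.iCycles j)]
  -- `X.X i` is an extension of `Z_j(X)` by `Z_i(X)`.
  have hXi : Subsingleton (Abelian.Ext (X.X i) (S.X₁.cycles i) 1) :=
    hses.subsingleton_ext_X₂ (h i i) (h j i)
  obtain ⟨l, hl, hl'⟩ := exists_lift_comp_g_and_comp_d hS hH hij hjk hXi (φ.f i)
    (X.toCycles i j ≫ τj) (by simp [hj]) (by simp [hj'])
  -- `l` has the right image and differential but may not restrict to `τi`. The discrepancy `μ`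
  -- lands in the cycles of `S.X₁`, so an extension `ν` of it to `X.X i` can be subtracted without
  -- disturbing either condition on `l`.
  obtain ⟨μ, hμ⟩ := exists_comp_iCycles_comp_f hS hij (X.iCycles i ≫ l - τi) (by simp [hl, hi])
    (by rw [Preadditive.sub_comp, Category.assoc, hl', hi', reassoc_of% hz, zero_comp, sub_zero])
  obtain ⟨ν, hν⟩ : ∃ ν : X.X i ⟶ S.X₁.cycles i, X.iCycles i ≫ ν = μ :=
    hses.exists_extension (h j i) μ
  refine ⟨l - ν ≫ S.X₁.iCycles i ≫ S.f.f i, ?_, ?_, ?_⟩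
  · simp [HomologicalComplex.f_f_comp_g_f, hl]
  · simp [hl']
  · rw [Preadditive.comp_sub, reassoc_of% hν, hμ, sub_sub_cancel]

/-- Let `S` be a short exact sequence of complexes and `X` a complex such that `X` and `S.X₁`
are exact. If `Ext¹` from the cycles of `X` to those of `S.X₁` vanishes, then every morphism
`X ⟶ S.X₃` lifts to `S.X₂`. -/
lemma exists_lift_of_subsingleton_ext_cycles {X : ChainComplex (ModuleCat.{u} R) ℤ}
    (hS : S.ShortExact) (hX : X.Acyclic) (hH : S.X₁.Acyclic)
    (h : ∀ i i', Subsingleton (Abelian.Ext (X.cycles i) (S.X₁.cycles i') 1))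
    (φ : X ⟶ S.X₃) : ∃ σ : X ⟶ S.X₂, σ ≫ S.g = φ := by
  have rel (i : ℤ) : (ComplexShape.down ℤ).Rel i (i - 1) := by simp
  -- Taking the prescribed differential to be 0 makes each `τ i` land in cycles.
  choose τ hτ hτ' using fun i ↦ exists_lift_comp_g_and_comp_d hS hH (rel i) (rel _) (h i i)
    (X.iCycles i ≫ φ.f i) (0 : _ ⟶ S.X₂.X (i - 1)) (by simp) (by simp)
  choose σ hσ hσ' hσi using fun i ↦ exists_lift_extending hS hX hH h φ (rel i) (rel _)
    (τ i) (τ (i - 1)) (hτ i) (hτ' i) (hτ _) (hτ' _)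
  refine ⟨{ f := σ, comm' := ?_ }, by ext i : 1; exact hσ i⟩
  intro i j hij
  obtain rfl : j = i - 1 := by simp at hij; omega
  -- `σ i` has differential given by `τ (i - 1)`, which is also the restriction of `σ (i - 1)` to
  -- cycles; hence the separate choices commute with `d`.
  rw [hσ', ← hσi, X.toCycles_i_assoc]

end Lift

/-- If `X` and `H` are exact complexes and `Ext¹` from the cycles of `X` to those of `H` vanishes,
then `Ext¹(X, H)` vanishes in the category of complexes. -/
lemma subsingleton_ext_one_of_cycles {X H : ChainComplex (ModuleCat.{u} R) ℤ}
    (hX : X.Acyclic) (hH : H.Acyclic)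
    (h : ∀ i i', Subsingleton (Abelian.Ext (X.cycles i) (H.cycles i') 1)) :
    Subsingleton (Abelian.Ext X H 1) := by
  have hS : (ShortComplex.mk (Injective.ι H) (cokernel.π (Injective.ι H))
      (cokernel.condition _)).ShortExact :=
    { exact := ShortComplex.exact_of_g_is_cokernel _ (cokernelIsCokernel _) }
  exact hS.subsingleton_ext_one_of_injective
    (exists_lift_of_subsingleton_ext_cycles hS hX hH h)

end ChainComplex

theorem proposition2p5 {R : Type u} [CommRing R]
    (C : ModuleCat.{u} R) (hC : DingComplex.IsSemidualizing C)
    (X : ChainComplex (ModuleCat.{u} R) ℤ)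
    (hX : X.Acyclic)
    (hZ : ∀ i : ℤ, DingComplex.IsDCProjective C (X.cycles i))
    (H : ChainComplex (ModuleCat.{u} R) ℤ) (hH : DingComplex.IsCFlatComplex C H) :
    Subsingleton (Abelian.Ext X H 1) :=
  ChainComplex.subsingleton_ext_one_of_cycles hX hH.1 fun i i' ↦
    (hZ i).subsingleton_ext_one (hH.2 i')
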